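/- \textbf{Theorem (Separation with ATOL).} Let $R>0$, $M\in\mathbb N$, and let $D^{(1)},\dots,D^{(L)}$ be measures on $\mathbb R^2$, each a sum of at most $M$ Dirac masses at points of the closed disc $\mathcal B(0,R)$ (for example persistence diagrams in this disc), whose supports are pairwise different sets. Then there is $\eta_0>0$ such that for every noise level $\eta\in[0,\eta_0]$ there is a segment $[\sigma_-,\sigma_+]$ with $0<\sigma_-<\sigma_+$ for which the following holds. For all weights $\pi_1,\dots,\pi_L\ge 0$ with $\sum_l\pi_l=1$ and every $\delta>0$ there are $b_0,n_0$ such that for all $b\ge b_0$ and $n\ge n_0$: Let $(D_1,Z_1),\dots,(D_n,Z_n)$ be i.i.d. copies of a random pair $(D,Z)$ with $\mathbb P(Z=l)=\pi_l$, where almost surely $D$ is a sum of at most $M$ Dirac masses in $\mathcal B(0,R)$ obtained from $D^{(Z)}$ by displacing each of its points by at most $\eta$. Assume that the mean measure $m=\mathbb E(D)$ satisfies the margin condition for $b$ points: for some $r_0>0$, every minimizer $c$ of $c\mapsto\int\min_j\|u-c_j\|^2\,m(du)$ over $\mathcal B(0,R)^b$ and every $t\in[0,r_0]$, $$m\big(\{x: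 d(x,N(c))\le t\}\big)\le \frac{B\,p_{\min}}{128R^2}\,t,$$ where $N(c)$ is the set of points having at least two nearest points among $c_1,\dots,c_b$, and $B$ and $p_{\min}$ are the infima over all minimizers of, respectively, the distance between two of the points $c_i,c_j$ ($i\ne j$) and the $m$-mass of a Voronoi cell $W_j(c)$ (ties assigned to the smallest index). Let $\bar X_n=\frac1n\sum_i D_i$. Given the data, draw $c^{(0)}_1,\dots,c^{(0)}_b$ independently from $\bar X_n/\bar X_n(\mathbb R^2)$ (arbitrary if $\bar X_n=0$), and run Lloyd's algorithm from $c^{(0)}$: at each step every $c_i$ is replaced by the $\bar X_n$-mean of its cell $W_i(c)$ (and kept if the cell has mass $0$), until $c$ no longer changes. Then, with probability at least $1-\delta$, the algorithm terminates with a codebook $\hat c$ such that for all bandwidths $\sigma_1,\dots,\sigma_b\in[\sigma_-,\sigma_+]$ the vectorization $v(X)=\big(\int e^{-\|x-\hat c_i\|/\sigma_i}\,X(dx)\big)_{1\le i\le b}$ satisfies, for all $i,j\in\{1,\dots,n\}$, $$Z_i=Z_j\implies\|v(D_i)-v(D_j)\|_\infty\le \tfrac14,\qquad Z_i\ne Z_j\implies\|v(D_i)-v(D_j)\|_\infty\ge\tfrac12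 .$$ -/

import Mathlib

open MeasureTheory ProbabilityTheory
open scoped ENNReal

noncomputable section

/-- Codebooks of size `b` in `ℝ^d`. -/
abbrev Codebook (d b : ℕ) : Type := Fin b → EuclideanSpace ℝ (Fin d)

/-- The Voronoi cell of the `j`-th codepoint; ties go to the smallest index. -/
def voronoiCell {d b : ℕ} (c : Codebook d b) (j : Fin b) : Set (EuclideanSpace ℝ (Fin d)) :=
  {x | (∀ i, i < j → ‖x - c j‖ < ‖x - c i‖) ∧ (∀ i, j < i → ‖x - c j‖ ≤ ‖x - c i‖)}

/-- The points that have at least two nearest codepoints (the union of the boundaries of the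
Voronoi cells). -/
def voronoiBoundary {d b : ℕ} (c : Codebook d b) : Set (EuclideanSpace ℝ (Fin d)) :=
  {x | ∃ i j, i ≠ j ∧ (∀ k, ‖x - c i‖ ≤ ‖x - c k‖) ∧ (∀ k, ‖x - c j‖ ≤ ‖x - c k‖)}

/-- The measure `∑ δ_p` of a diagram: finitely many points, counted with multiplicity, at most
`M` of them, all in the closed ball of radius `R` about the origin. -/
def IsDiagram {d : ℕ} (R : ℝ) (M : ℕ) (μ : Measure (EuclideanSpace ℝ (Fin d))) : Prop :=
  ∃ k : ℕ, k ≤ M ∧ ∃ x : Fin k → EuclideanSpace ℝ (Fin d),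
    (∀ i, x i ∈ Metric.closedBall 0 R) ∧ μ = ∑ i, Measure.dirac (x i)

/-- `ν` is obtained from `μ` by displacing each point of `μ` by at most `η`. -/
def IsPerturbation {d : ℕ} (η : ℝ) (μ ν : Measure (EuclideanSpace ℝ (Fin d))) : Prop :=
  ∃ (k : ℕ) (x y : Fin k → EuclideanSpace ℝ (Fin d)),
    μ = ∑ i, Measure.dirac (x i) ∧ ν = ∑ i, Measure.dirac (y i) ∧ ∀ i, dist (x i) (y i) ≤ η

/-- `Q` is the joint law of `(D, Z)`, where the latent label `Z` equals `l` with probability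
`w l`, and given `Z = l` the random diagram `D` is `D₀ l` observed with noise of level `η`. -/
structure IsNoisyMixture {d L : ℕ} (R : ℝ) (M : ℕ)
    (D₀ : Fin L → Measure (EuclideanSpace ℝ (Fin d))) (w : Fin L → ℝ) (η : ℝ)
    (Q : Measure (Measure (EuclideanSpace ℝ (Fin d)) × Fin L)) : Prop where
  prob : IsProbabilityMeasure Q
  weight : ∀ l, Q (Prod.snd ⁻¹' {l}) = ENNReal.ofReal (w l)
  noise : ∀ᵐ p ∂Q, IsDiagram R M p.1 ∧ IsPerturbation η (D₀ p.2) p.1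

/-- The mean measure `E(D)`, that is `A ↦ ∫ D(A)`, for `(D, Z)` of law `Q`. -/
def meanMeasure {d L : ℕ} (Q : Measure (Measure (EuclideanSpace ℝ (Fin d)) × Fin L)) :
    Measure (EuclideanSpace ℝ (Fin d)) :=
  Q.bind Prod.fst

/-- The `k`-means distortion of a codebook with respect to `m`. -/
def distortion {d b : ℕ} (m : Measure (EuclideanSpace ℝ (Fin d))) (c : Codebook d b) : ℝ≥0∞ :=
  ∫⁻ u, ⨅ j, edist u (c j) ^ 2 ∂m

/-- The optimal codebooks of size `b` in the ball of radius `R`. -/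
def optimalCodebooks {d : ℕ} (R : ℝ) (b : ℕ) (m : Measure (EuclideanSpace ℝ (Fin d))) :
    Set (Codebook d b) :=
  {c | (∀ j, c j ∈ Metric.closedBall 0 R) ∧
    ∀ c' : Codebook d b, (∀ j, c' j ∈ Metric.closedBall 0 R) → distortion m c ≤ distortion m c'}

/-- The smallest distance between two codepoints of an optimal codebook. -/
def optimalSeparation {d : ℕ} (R : ℝ) (b : ℕ) (m : Measure (EuclideanSpace ℝ (Fin d))) : ℝ≥0∞ :=
  ⨅ c ∈ optimalCodebooks R b m, ⨅ i, ⨅ j, ⨅ _ : i ≠ j, edist (c i) (c j)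

/-- The smallest mass of a cell of an optimal codebook. -/
def optimalCellMass {d : ℕ} (R : ℝ) (b : ℕ) (m : Measure (EuclideanSpace ℝ (Fin d))) : ℝ≥0∞ :=
  ⨅ c ∈ optimalCodebooks R b m, ⨅ j, m (voronoiCell c j)

/-- The margin condition of radius `r₀`: for every optimal codebook, the mass within distance
`t ≤ r₀` of the boundaries of the cells is at most `B p_min / (128 R ^ 2) * t`. -/
def MarginCondition {d : ℕ} (R : ℝ) (b : ℕ) (m : Measure (EuclideanSpace ℝ (Fin d)))
    (r₀ : ℝ) : Prop :=
  ∀ c ∈ optimalCodebooks R b m, ∀ t : ℝ, 0 ≤ t → t ≤ r₀ →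
    m (Metric.cthickening t (voronoiBoundary c)) ≤
      optimalSeparation R b m * optimalCellMass R b m / ENNReal.ofReal (128 * R ^ 2) *
        ENNReal.ofReal t

/-- The empirical mean measure of `n` measures. -/
def empiricalMean {d n : ℕ} (D : Fin n → Measure (EuclideanSpace ℝ (Fin d))) :
    Measure (EuclideanSpace ℝ (Fin d)) :=
  (n : ℝ≥0∞)⁻¹ • ∑ i, D i

open Classical in
/-- One step of Lloyd's algorithm for the measure `m`: each codepoint moves to the centre of
mass of its cell, and stays where it is if its cell has no mass. -/
def lloydStep {d b : ℕ} (m : Measure (EuclideanSpace ℝ (Fin d))) (c : Codebook d b) :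
    Codebook d b :=
  fun i => if m (voronoiCell c i) = 0 then c i else ⨍ u in voronoiCell c i, u ∂m

/-- Lloyd's algorithm for `m`, started at `c₀`, terminates and returns `c`. -/
def LloydReturns {d b : ℕ} (m : Measure (EuclideanSpace ℝ (Fin d))) (c₀ c : Codebook d b) : Prop :=
  ∃ t : ℕ, c = (lloydStep m)^[t] c₀ ∧ lloydStep m c = c

/-- The conditional law of the random codebook `c₀` given the data `X` (pairs of a measure and a
label): its `b` points are drawn independently from the normalized empirical mean measure.
Nothing is required of `c₀` where the empirical mean measure is zero. -/
def IsSampledFromMean {d L n b : ℕ} {Ω : Type*} [MeasurableSpace Ω] (P : Measure Ω)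
    (X : Fin n → Ω → Measure (EuclideanSpace ℝ (Fin d)) × Fin L) (c₀ : Ω → Codebook d b) : Prop :=
  ∀ T : Set (Fin n → Measure (EuclideanSpace ℝ (Fin d)) × Fin L), MeasurableSet T →
    (∀ x ∈ T, empiricalMean (fun i => (x i).1) ≠ 0) →
    ∀ S : Set (Codebook d b), MeasurableSet S →
      P {ω | (fun i => X i ω) ∈ T ∧ c₀ ω ∈ S} =
        ∫⁻ ω in {ω | (fun i => X i ω) ∈ T},
          Measure.pi (fun _ : Fin b =>
            (empiricalMean (fun i => (X i ω).1) Set.univ)⁻¹ •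
              empiricalMean (fun i => (X i ω).1)) S ∂P

/-- The vectorization with Laplacian contrast functions of centres `c` and bandwidths `σ`. -/
def vAtol {d b : ℕ} (c : Codebook d b) (σ : Fin b → ℝ) (D : Measure (EuclideanSpace ℝ (Fin d))) :
    Fin b → ℝ :=
  fun i => ∫ x, Real.exp (-(‖x - c i‖ / σ i)) ∂D

/-- The vectorizations of the data separate the labels. -/
def Separates {d L n b : ℕ} (c : Codebook d b) (σ : Fin b → ℝ)
    (x : Fin n → Measure (EuclideanSpace ℝ (Fin d)) × Fin L) : Prop :=
  ∀ i j,
    ((x i).2 = (x j).2 → ‖vAtol c σ (x i).1 - vAtol c σ (x j).1‖ ≤ 1 / 4) ∧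
    ((x i).2 ≠ (x j).2 → 1 / 2 ≤ ‖vAtol c σ (x i).1 - vAtol c σ (x j).1‖)

end

/-! A contrast function centred near a support point `p` detects whether a diagram has a point near
`p`. Let `Δ` separate the finitely many support points of all `D₀ l`, and suppose that a codepoint
lies within `ρ` of `p`. With bandwidth at least `4 (ρ + η)`, a diagram with a point within `η` of
`p` scores at least `3/4`. If the bandwidth is also small compared with `Δ / log (4 (M + 1))`, a
diagram whose label lacks `p` scores at most `1/4` (`le_norm_vAtol_sub`). Equal labels stay close
because the contrast functions are Lipschitz (`norm_vAtol_sub_le`).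

It remains to put a codepoint near every support point of every label that occurs. Optimality of the
codebook is not needed, only a small quantization cost: if no codepoint were near `p`, every diagram
of that label would pay for its point near `p`, and the label is frequent
(`measure_label_count_lt_le`, `exists_codepoint_near`). Lloyd's algorithm terminates without raising
the cost (`exists_lloydReturns`), so a cheap initial codebook suffices. For large `b` the random
codebook meets every heavy ball of a fine finite cover (`IsSampledFromMean.measure_avoid_le`), and
the light balls carry little mass (`quantizationCost_le_of_hit`). -/

section Lloyd

variable {d b : ℕ}

/-! ### Voronoi cells -/

theorem norm_sub_le_of_mem_voronoiCell {c : Codebook d b} {j : Fin b}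
    {u : EuclideanSpace ℝ (Fin d)} (hu : u ∈ voronoiCell c j) (i : Fin b) :
    ‖u - c j‖ ≤ ‖u - c i‖ := by
  rcases lt_trichotomy i j with h | h | h
  · exact (hu.1 i h).le
  · rw [h]
  · exact hu.2 i h

theorem eq_of_mem_voronoiCell {c : Codebook d b} {i j : Fin b}
    {u : EuclideanSpace ℝ (Fin d)} (hi : u ∈ voronoiCell c i) (hj : u ∈ voronoiCell c j) :
    i = j := by
  rcases lt_trichotomy i j with h | h | h
  · exact absurd (hi.2 j h) (not_le.2 (hj.1 i h))
  · exact h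
  · exact absurd (hj.2 i h) (not_le.2 (hi.1 j h))

theorem exists_mem_voronoiCell [NeZero b] (c : Codebook d b) (u : EuclideanSpace ℝ (Fin d)) :
    ∃ j, u ∈ voronoiCell c j := by
  classical
  obtain ⟨j₀, -, hj₀⟩ := Finset.exists_min_image Finset.univ (fun j => ‖u - c j‖)
    ⟨0, Finset.mem_univ _⟩
  let S : Finset (Fin b) := {j | ∀ i, ‖u - c j‖ ≤ ‖u - c i‖}
  have hS : S.Nonempty := ⟨j₀, by simpa [S] using hj₀⟩
  have hmin : ∀ i, ‖u - c (S.min' hS)‖ ≤ ‖u - c i‖ := by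
    simpa [S] using S.min'_mem hS
  refine ⟨S.min' hS, fun i hi => ?_, fun i _ => hmin i⟩
  by_contra hle
  have hiS : i ∈ S := by
    simp only [S, Finset.mem_filter, Finset.mem_univ, true_and]
    exact fun k => (not_lt.1 hle).trans (hmin k)
  exact absurd (S.min'_le i hiS) (not_le.2 hi)

theorem measurableSet_voronoiCell (c : Codebook d b) (j : Fin b) :
    MeasurableSet (voronoiCell c j) := by
  have h : voronoiCell c j = (⋂ i, ⋂ _ : i < j, {x | ‖x - c j‖ < ‖x - c i‖}) ∩
      ⋂ i, ⋂ _ : j < i, {x | ‖x - c j‖ ≤ ‖x - c i‖} := by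
    ext x; simp [voronoiCell]
  rw [h]
  refine .inter (.iInter fun i => .iInter fun _ => measurableSet_lt ?_ ?_)
    (.iInter fun i => .iInter fun _ => measurableSet_le ?_ ?_) <;> fun_prop

/-! ### Lloyd's algorithm on finitely many equal point masses -/

variable {ι : Type*}

open Classical in
/-- The mean of a finite family of points over a set of indices. -/
noncomputable def pointMean (x : ι → EuclideanSpace ℝ (Fin d)) (s : Finset ι) :
    EuclideanSpace ℝ (Fin d) :=
  (s.card : ℝ)⁻¹ • ∑ k ∈ s, x k

/-- Parallel axis identity: the cross term vanishes because the deviations from the mean sum to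
zero. -/
theorem sum_norm_sub_sq_eq_pointMean (x : ι → EuclideanSpace ℝ (Fin d)) {s : Finset ι}
    (hs : s.Nonempty) (v : EuclideanSpace ℝ (Fin d)) :
    ∑ k ∈ s, ‖x k - v‖ ^ 2 =
      ∑ k ∈ s, ‖x k - pointMean x s‖ ^ 2 + s.card * ‖pointMean x s - v‖ ^ 2 := by
  have hcard : (s.card : ℝ) ≠ 0 := by exact_mod_cast hs.card_pos.ne'
  have hzero : ∑ k ∈ s, (x k - pointMean x s) = 0 := by
    rw [Finset.sum_sub_distrib, Finset.sum_const, pointMean, ← Nat.cast_smul_eq_nsmul ℝ, smul_smul,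
      mul_inv_cancel₀ hcard, one_smul, sub_self]
  have hk : ∀ k, ‖x k - v‖ ^ 2 = ‖x k - pointMean x s‖ ^ 2 +
      2 * inner ℝ (x k - pointMean x s) (pointMean x s - v) + ‖pointMean x s - v‖ ^ 2 := by
    intro k
    rw [← norm_add_sq_real, sub_add_sub_cancel]
  simp_rw [hk]
  rw [Finset.sum_add_distrib, Finset.sum_add_distrib, ← Finset.mul_sum, ← sum_inner, hzero]
  simp

variable [Fintype ι]

open Classical in
/-- The indices of the points of a finite family that lie in a given cell. -/
noncomputable def cellIndices (x : ι → EuclideanSpace ℝ (Fin d)) (c : Codebook d b) (j : Fin b) :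
    Finset ι :=
  {k | x k ∈ voronoiCell c j}

open Classical in
theorem smul_sum_dirac_apply (a : ℝ≥0∞) (x : ι → EuclideanSpace ℝ (Fin d))
    {A : Set (EuclideanSpace ℝ (Fin d))} (hA : MeasurableSet A) :
    (a • ∑ k, Measure.dirac (x k)) A = a * (Finset.card {k | x k ∈ A} : ℕ) := by
  simp [Measure.smul_apply, Measure.finsetSum_apply, Measure.dirac_apply' _ hA,
    Set.indicator_apply]

open Classical in
theorem setIntegral_smul_sum_dirac (a : ℝ≥0∞) (x : ι → EuclideanSpace ℝ (Fin d))
    {A : Set (EuclideanSpace ℝ (Fin d))} (hA : MeasurableSet A) :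
    ∫ u in A, u ∂(a • ∑ k, Measure.dirac (x k)) =
      a.toReal • ∑ k ∈ Finset.univ.filter (fun k => x k ∈ A), x k := by
  rw [← integral_indicator hA, integral_smul_measure, integral_finsetSum_measure]
  · simp [integral_dirac, Set.indicator_apply, Finset.sum_filter]
  · intro i _
    exact integrable_dirac (by simp [enorm_lt_top])

/-- The common mass `a` cancels in the average, so a step depends only on which points lie in which
cell. Every new codepoint is then a mean over one of finitely many index sets. -/
theorem lloydStep_smul_sum_dirac (a : ℝ≥0∞) (ha0 : a ≠ 0) (ha : a ≠ ∞)
    (x : ι → EuclideanSpace ℝ (Fin d)) (c : Codebook d b) (i : Fin b) :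
    lloydStep (a • ∑ k, Measure.dirac (x k)) c i =
      if (cellIndices x c i).card = 0 then c i else pointMean x (cellIndices x c i) := by
  classical
  have hm := smul_sum_dirac_apply a x (measurableSet_voronoiCell c i)
  have hcard : (Finset.card {k | x k ∈ voronoiCell c i}) = (cellIndices x c i).card := by
    unfold cellIndices; congr!
  rw [hcard] at hm
  unfold lloydStep
  rw [hm]
  by_cases h : (cellIndices x c i).card = 0
  · simp [h]
  · have hne : ¬ (a * ((cellIndices x c i).card : ℕ) = 0) := by
      simp only [mul_eq_zero, ha0, Nat.cast_eq_zero, h, or_self, not_false_eq_true]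
    simp only [hne, h, if_false]
    rw [setAverage_eq, setIntegral_smul_sum_dirac a x (measurableSet_voronoiCell c i),
      measureReal_def, hm, pointMean, smul_smul]
    have ha' : a.toReal ≠ 0 := ENNReal.toReal_ne_zero.2 ⟨ha0, ha⟩
    congr 1
    · simp only [ENNReal.toReal_mul, ENNReal.toReal_natCast]
      field_simp

/-- The sum of the squared distances of a finite family of points to a codebook. -/
noncomputable def quantizationCost (x : ι → EuclideanSpace ℝ (Fin d)) (c : Codebook d b) : ℝ :=
  ∑ k, Metric.infDist (x k) (Set.range c) ^ 2

theorem infDist_range_le (c : Codebook d b) (u : EuclideanSpace ℝ (Fin d)) (j : Fin b) :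
    Metric.infDist u (Set.range c) ≤ ‖u - c j‖ := by
  rw [← dist_eq_norm]
  exact Metric.infDist_le_dist_of_mem (Set.mem_range_self j)

theorem infDist_range_of_mem_voronoiCell [NeZero b] {c : Codebook d b}
    {u : EuclideanSpace ℝ (Fin d)} {j : Fin b} (hu : u ∈ voronoiCell c j) :
    Metric.infDist u (Set.range c) = ‖u - c j‖ := by
  refine le_antisymm (infDist_range_le c u j) ?_
  refine (Metric.le_infDist (Set.range_nonempty c)).2 ?_
  rintro _ ⟨i, rfl⟩
  rw [dist_eq_norm]
  exact norm_sub_le_of_mem_voronoiCell hu i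

theorem sum_cellIndices [NeZero b] (x : ι → EuclideanSpace ℝ (Fin d)) (c : Codebook d b)
    (f : ι → ℝ) : ∑ j, ∑ k ∈ cellIndices x c j, f k = ∑ k, f k := by
  classical
  choose g hg using fun k => exists_mem_voronoiCell c (x k)
  have h : ∀ j, cellIndices x c j = Finset.univ.filter (fun k => g k = j) := by
    intro j
    ext k
    simp only [cellIndices, Finset.mem_filter, Finset.mem_univ, true_and]
    exact ⟨fun hk => eq_of_mem_voronoiCell (hg k) hk, fun hk => hk ▸ hg k⟩
  simp_rw [h]
  exact Finset.sum_fiberwise _ _ _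

theorem quantizationCost_eq [NeZero b] (x : ι → EuclideanSpace ℝ (Fin d)) (c : Codebook d b) :
    quantizationCost x c = ∑ j, ∑ k ∈ cellIndices x c j, ‖x k - c j‖ ^ 2 := by
  rw [quantizationCost, ← sum_cellIndices x c]
  refine Finset.sum_congr rfl fun j _ => Finset.sum_congr rfl fun k hk => ?_
  rw [infDist_range_of_mem_voronoiCell (j := j)]
  simpa [cellIndices] using hk

/-- Keeping the assignment made by the old codebook can only overestimate the cost of the new one.
-/
theorem quantizationCost_le [NeZero b] (x : ι → EuclideanSpace ℝ (Fin d)) (c c' : Codebook d b) :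
    quantizationCost x c' ≤ ∑ j, ∑ k ∈ cellIndices x c j, ‖x k - c' j‖ ^ 2 := by
  rw [quantizationCost, ← sum_cellIndices x c]
  gcongr with j _ k hk
  · exact Metric.infDist_nonneg
  · exact infDist_range_le c' (x k) j

/-- With the assignment frozen, the parallel axis identity gives a gain of the cell's cardinality
times the squared displacement. A codepoint that moves has a nonempty cell, so its gain is positive.
-/
theorem quantizationCost_lloydStep_lt [NeZero b] (a : ℝ≥0∞) (ha0 : a ≠ 0) (ha : a ≠ ∞)
    (x : ι → EuclideanSpace ℝ (Fin d)) (c : Codebook d b)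
    (hc : lloydStep (a • ∑ k, Measure.dirac (x k)) c ≠ c) :
    quantizationCost x (lloydStep (a • ∑ k, Measure.dirac (x k)) c) < quantizationCost x c := by
  set c' := lloydStep (a • ∑ k, Measure.dirac (x k)) c with hc'
  refine (quantizationCost_le x c c').trans_lt ?_
  rw [quantizationCost_eq]
  have hstep : ∀ i, c' i = if (cellIndices x c i).card = 0 then c i else pointMean x (cellIndices x c i) :=
    lloydStep_smul_sum_dirac a ha0 ha x c
  have hcell : ∀ j, ∑ k ∈ cellIndices x c j, ‖x k - c j‖ ^ 2 =
      ∑ k ∈ cellIndices x c j, ‖x k - c' j‖ ^ 2 + (cellIndices x c j).card * ‖c' j - c j‖ ^ 2 := by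
    intro j
    rw [hstep j]
    split_ifs with h
    · simp [Finset.card_eq_zero.1 h]
    · exact sum_norm_sub_sq_eq_pointMean x (Finset.card_pos.1 (Nat.pos_of_ne_zero h)) (c j)
  obtain ⟨i, hi⟩ := Function.ne_iff.1 hc
  refine Finset.sum_lt_sum (fun j _ => ?_) ⟨i, Finset.mem_univ i, ?_⟩
  · rw [hcell j]
    exact le_add_of_nonneg_right (by positivity)
  · rw [hcell i]
    refine lt_add_of_pos_right _ (mul_pos ?_ (pow_pos (norm_pos_iff.2 (sub_ne_zero.2 hi)) 2))
    have hne : (cellIndices x c i).card ≠ 0 := by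
      intro h
      have := hstep i
      rw [if_pos h] at this
      exact hi this
    exact_mod_cast Nat.pos_of_ne_zero hne

/-- Iterating a map that decreases a real function at every non-fixed point leads to a fixed
point, provided that the orbit is finite. -/
theorem exists_iterate_fixed {α : Type*} (f : α → α) (F : α → ℝ)
    (hF : ∀ c, f c ≠ c → F (f c) < F c) (c₀ : α)
    (hfin : (Set.range fun t : ℕ => f^[t] c₀).Finite) :
    ∃ t, f (f^[t] c₀) = f^[t] c₀ ∧ F (f^[t] c₀) ≤ F c₀ := by
  have hle : ∀ c, F (f c) ≤ F c := by
    intro c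
    by_cases h : f c = c
    · rw [h]
    · exact (hF c h).le
  have hanti : Antitone fun t => F (f^[t] c₀) :=
    antitone_nat_of_succ_le fun t => by
      simpa only [Function.iterate_succ_apply'] using hle _
  have hfix : ∃ t, f (f^[t] c₀) = f^[t] c₀ := by
    by_contra! hne
    have hstrict : StrictAnti fun t => F (f^[t] c₀) :=
      strictAnti_nat_of_succ_lt fun t => by
        simpa only [Function.iterate_succ_apply'] using hF _ (hne t)
    have hinj : Function.Injective fun t => f^[t] c₀ := fun s t hst =>
      hstrict.injective (congrArg F hst)
    exact Set.infinite_range_of_injective hinj hfin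
  obtain ⟨t, ht⟩ := hfix
  exact ⟨t, ht, hanti (Nat.zero_le t)⟩

/-- Along the orbit each codepoint is either its initial value or the mean of a subset of the
points. -/
theorem finite_range_iterate_lloydStep (a : ℝ≥0∞) (ha0 : a ≠ 0) (ha : a ≠ ∞)
    (x : ι → EuclideanSpace ℝ (Fin d)) (c₀ : Codebook d b) :
    (Set.range fun t : ℕ => (lloydStep (a • ∑ k, Measure.dirac (x k)))^[t] c₀).Finite := by
  have hA : (Set.univ.pi fun i : Fin b => insert (c₀ i) (Set.range (pointMean x))).Finite :=
    Set.Finite.pi fun i => (Set.finite_range (pointMean x)).insert _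
  refine hA.subset ?_
  rintro _ ⟨t, rfl⟩ i -
  induction t with
  | zero => exact Set.mem_insert _ _
  | succ t ih =>
    beta_reduce
    rw [Function.iterate_succ_apply', lloydStep_smul_sum_dirac a ha0 ha]
    split_ifs
    · exact ih
    · exact Set.mem_insert_of_mem _ (Set.mem_range_self _)

/-- Lloyd's algorithm terminates on a finite sum of equal point masses, and does not increase the
quantization cost. -/
theorem exists_lloydReturns [NeZero b] (a : ℝ≥0∞) (ha0 : a ≠ 0) (ha : a ≠ ∞)
    (x : ι → EuclideanSpace ℝ (Fin d)) (c₀ : Codebook d b) :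
    ∃ c, LloydReturns (a • ∑ k, Measure.dirac (x k)) c₀ c ∧
      quantizationCost x c ≤ quantizationCost x c₀ := by
  obtain ⟨t, ht, hle⟩ := exists_iterate_fixed (lloydStep (a • ∑ k, Measure.dirac (x k)))
    (quantizationCost x) (quantizationCost_lloydStep_lt a ha0 ha x) c₀
    (finite_range_iterate_lloydStep a ha0 ha x c₀)
  exact ⟨_, ⟨t, rfl, ht⟩, hle⟩

end Lloyd

/-! ### Stability and separation of the vectorizations -/

section Vectorization

variable {d b : ℕ}

theorem support_sum_dirac {k : ℕ} (x : Fin k → EuclideanSpace ℝ (Fin d)) :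
    (∑ i, Measure.dirac (x i)).support = Set.range x := by
  ext p
  constructor
  · intro hp
    by_contra hne
    have hopen : IsOpen (Set.range x)ᶜ := (Set.finite_range x).isClosed.isOpen_compl
    have hpos := (Measure.mem_support_iff_forall p).1 hp _ (hopen.mem_nhds hne)
    rw [Measure.finsetSum_apply, Finset.sum_eq_zero] at hpos
    · exact lt_irrefl _ hpos
    · intro i _
      simp [Measure.dirac_apply' _ hopen.measurableSet]
  · rintro ⟨i, rfl⟩
    refine (Measure.mem_support_iff_forall _).2 fun U hU => ?_
    rw [Measure.finsetSum_apply]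
    refine lt_of_lt_of_le ?_ (Finset.single_le_sum (f := fun j => Measure.dirac (x j) U)
      (fun _ _ => zero_le) (Finset.mem_univ i))
    simp [Measure.dirac_apply_of_mem (mem_of_mem_nhds hU)]

theorem card_eq_of_sum_dirac_eq {k l : ℕ} {x : Fin k → EuclideanSpace ℝ (Fin d)}
    {y : Fin l → EuclideanSpace ℝ (Fin d)}
    (h : ∑ i, Measure.dirac (x i) = ∑ i, Measure.dirac (y i)) : k = l := by
  have := congrArg (fun μ => μ Set.univ) h
  simpa [Measure.finsetSum_apply] using this

/-- The representation need not be the one supplied by `IsDiagram`; the total mass shows that both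
have the same number of points. -/
theorem IsDiagram.card_le {R : ℝ} {M k : ℕ} {x : Fin k → EuclideanSpace ℝ (Fin d)}
    (h : IsDiagram R M (∑ i, Measure.dirac (x i))) : k ≤ M := by
  obtain ⟨l, hl, y, -, hxy⟩ := h
  exact (card_eq_of_sum_dirac_eq hxy).trans_le hl

theorem IsDiagram.support_finite {R : ℝ} {M : ℕ} {μ : Measure (EuclideanSpace ℝ (Fin d))}
    (h : IsDiagram R M μ) : μ.support.Finite := by
  obtain ⟨k, -, x, -, rfl⟩ := h
  rw [support_sum_dirac]
  exact Set.finite_range x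

theorem vAtol_sum_dirac {k : ℕ} (c : Codebook d b) (σ : Fin b → ℝ)
    (x : Fin k → EuclideanSpace ℝ (Fin d)) (j : Fin b) :
    vAtol c σ (∑ i, Measure.dirac (x i)) j = ∑ i, Real.exp (-(‖x i - c j‖ / σ j)) := by
  rw [vAtol, integral_finsetSum_measure]
  · simp
  · intro i _
    exact integrable_dirac (by simp [enorm_lt_top])

theorem abs_exp_neg_sub_exp_neg_le {s t : ℝ} (hs : 0 ≤ s) (ht : 0 ≤ t) :
    |Real.exp (-s) - Real.exp (-t)| ≤ |s - t| := by
  have key : ∀ u v : ℝ, 0 ≤ u → Real.exp (-u) - Real.exp (-v) ≤ |u - v| := by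
    intro u v hu
    have h1 : Real.exp (-v) = Real.exp (-u) * Real.exp (u - v) := by
      rw [← Real.exp_add]; ring_nf
    have h2 := Real.add_one_le_exp (u - v)
    have h3 : Real.exp (-u) ≤ 1 := Real.exp_le_one_iff.2 (by linarith)
    have h4 := Real.exp_pos (-u)
    have h5 := neg_abs_le (u - v)
    have h6 := abs_nonneg (u - v)
    rw [h1]
    nlinarith
  rw [abs_le]
  constructor
  · have := key t s ht
    rw [abs_sub_comm] at this
    linarith
  · exact key s t hs

/-- Each coordinate is a sum of at most `M` terms, and each term is Lipschitz in the point with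
constant `1 / σ j ≤ 1 / σ₁`. -/
theorem norm_vAtol_sub_le {R η σ₁ : ℝ} {M : ℕ} {μ ν : Measure (EuclideanSpace ℝ (Fin d))}
    (hν : IsDiagram R M ν) (h : IsPerturbation η μ ν) (hη : 0 ≤ η) (hσ₁ : 0 < σ₁)
    (c : Codebook d b) {σ : Fin b → ℝ} (hσ : ∀ j, σ₁ ≤ σ j) :
    ‖vAtol c σ μ - vAtol c σ ν‖ ≤ M * (η / σ₁) := by
  obtain ⟨k, x, y, rfl, rfl, hxy⟩ := h
  have hk : (k : ℝ) ≤ M := by exact_mod_cast hν.card_le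
  refine (pi_norm_le_iff_of_nonneg (by positivity)).2 fun j => ?_
  have hσj : 0 < σ j := hσ₁.trans_le (hσ j)
  rw [Pi.sub_apply, vAtol_sum_dirac, vAtol_sum_dirac, ← Finset.sum_sub_distrib]
  calc ‖∑ i, (Real.exp (-(‖x i - c j‖ / σ j)) - Real.exp (-(‖y i - c j‖ / σ j)))‖
      ≤ ∑ _i : Fin k, η / σ₁ := by
        refine norm_sum_le_of_le _ fun i _ => ?_
        rw [Real.norm_eq_abs]
        refine (abs_exp_neg_sub_exp_neg_le (by positivity) (by positivity)).trans ?_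
        rw [← sub_div, abs_div, abs_of_pos hσj]
        have h1 : |‖x i - c j‖ - ‖y i - c j‖| ≤ η := by
          refine (abs_norm_sub_norm_le _ _).trans ?_
          rw [sub_sub_sub_cancel_right, ← dist_eq_norm]
          exact hxy i
        gcongr
        exact hσ j
    _ = k * (η / σ₁) := by simp
    _ ≤ M * (η / σ₁) := by gcongr

/-- Forgets the matching and keeps only that the points of `ν` and the support of `μ` are within
Hausdorff distance `η`, which is all that separation uses. -/
theorem IsPerturbation.exists_point {R η : ℝ} {M : ℕ} {μ ν : Measure (EuclideanSpace ℝ (Fin d))}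
    (h : IsPerturbation η μ ν) (hν : IsDiagram R M ν) :
    ∃ k ≤ M, ∃ y : Fin k → EuclideanSpace ℝ (Fin d), ν = ∑ i, Measure.dirac (y i) ∧
      (∀ p ∈ μ.support, ∃ i, dist (y i) p ≤ η) ∧ ∀ i, ∃ p ∈ μ.support, dist (y i) p ≤ η := by
  obtain ⟨k, x, y, rfl, rfl, hxy⟩ := h
  refine ⟨k, hν.card_le, y, rfl, ?_, ?_⟩
  · rw [support_sum_dirac]
    rintro _ ⟨i, rfl⟩
    exact ⟨i, by rw [dist_comm]; exact hxy i⟩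
  · rw [support_sum_dirac]
    exact fun i => ⟨x i, Set.mem_range_self i, by rw [dist_comm]; exact hxy i⟩

/-- A codepoint near a point of the support of `μ` that is far from the support of `μ'` separates
the vectorizations of perturbations of `μ` and `μ'`. -/
theorem le_norm_vAtol_sub {R η ρ Δ : ℝ} {M : ℕ}
    {μ ν μ' ν' : Measure (EuclideanSpace ℝ (Fin d))}
    (hν : IsDiagram R M ν) (h : IsPerturbation η μ ν)
    (hν' : IsDiagram R M ν') (h' : IsPerturbation η μ' ν')
    {p : EuclideanSpace ℝ (Fin d)} (hp : p ∈ μ.support) (hΔ : ∀ q ∈ μ'.support, Δ ≤ dist p q)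
    (c : Codebook d b) {σ : Fin b → ℝ} {j : Fin b} (hj : dist p (c j) ≤ ρ) (hσ : 0 < σ j)
    (hnear : ρ + η ≤ σ j / 4)
    (hfar : σ j * Real.log (4 * (M + 1)) ≤ Δ - ρ - η) :
    1 / 2 ≤ ‖vAtol c σ ν - vAtol c σ ν'‖ := by
  obtain ⟨k, -, y, rfl, hy, -⟩ := h.exists_point hν
  obtain ⟨k', hk', y', rfl, -, hy'⟩ := h'.exists_point hν'
  refine le_trans ?_ (norm_le_pi_norm _ j)
  rw [Pi.sub_apply, vAtol_sum_dirac, vAtol_sum_dirac, Real.norm_eq_abs]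
  refine le_trans ?_ (le_abs_self _)
  -- One point close to `p` suffices: `exp (-1/4) ≥ 1 - 1/4`.
  have hlow : 3 / 4 ≤ ∑ i, Real.exp (-(‖y i - c j‖ / σ j)) := by
    obtain ⟨i, hi⟩ := hy p hp
    refine le_trans ?_ (Finset.single_le_sum (f := fun i => Real.exp (-(‖y i - c j‖ / σ j)))
      (fun _ _ => (Real.exp_pos _).le) (Finset.mem_univ i))
    have h1 : ‖y i - c j‖ / σ j ≤ 1 / 4 := by
      rw [div_le_iff₀ hσ, ← dist_eq_norm]
      linarith [dist_triangle (y i) p (c j)]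
    linarith [Real.add_one_le_exp (-(‖y i - c j‖ / σ j))]
  -- Every point of `ν'` is at distance at least `Δ - ρ - η` from the codepoint, so each of the at
  -- most `M` terms is at most `1 / (4 (M + 1))`.
  have hup : ∑ i, Real.exp (-(‖y' i - c j‖ / σ j)) ≤ 1 / 4 := by
    have hM : (0 : ℝ) < 4 * (M + 1) := by positivity
    calc ∑ i, Real.exp (-(‖y' i - c j‖ / σ j)) ≤ ∑ _i : Fin k', (4 * ((M : ℝ) + 1))⁻¹ := by
          refine Finset.sum_le_sum fun i _ => ?_
          rw [Real.exp_neg]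
          refine inv_anti₀ hM ?_
          rw [← Real.log_le_iff_le_exp hM, le_div_iff₀ hσ, mul_comm]
          refine hfar.trans ?_
          obtain ⟨q, hq, hqi⟩ := hy' i
          rw [← dist_eq_norm]
          have h1 := hΔ q hq
          have h2 := dist_triangle4 p (c j) (y' i) q
          rw [dist_comm (c j)] at h2
          linarith
      _ = k' * (4 * ((M : ℝ) + 1))⁻¹ := by simp
      _ ≤ 1 / 4 := by
          have : (k' : ℝ) ≤ M := by exact_mod_cast hk'
          rw [← div_eq_mul_inv, div_le_iff₀ hM]
          linarith
  linarith

end Vectorization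

/-! ### Label frequencies and random initialization -/

section Probability

/-- A label of probability `w > 0` has frequency less than `w / 2` with probability at most
`1 / (n w ^ 2)`. -/
theorem measure_label_count_lt_le {Ω E κ : Type*} [MeasurableSpace Ω] [MeasurableSpace E]
    [MeasurableSpace κ] [MeasurableSingletonClass κ] [DecidableEq κ] {n : ℕ} (hn : 0 < n) (P : Measure Ω)
    [IsProbabilityMeasure P] (X : Fin n → Ω → E × κ) (hX : ∀ i, Measurable (X i))
    (hind : iIndepFun X P) {Q : Measure (E × κ)} (hQ : ∀ i, P.map (X i) = Q) {l : κ} {w : ℝ}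
    (hw : 0 < w) (hl : Q (Prod.snd ⁻¹' {l}) = ENNReal.ofReal w) :
    P {ω | ((Finset.card {i | (X i ω).2 = l} : ℕ) : ℝ) < n * w / 2} ≤
      ENNReal.ofReal (1 / (n * w ^ 2)) := by
  classical
  let A : Set (E × κ) := Prod.snd ⁻¹' {l}
  have hA : MeasurableSet A := measurable_snd (measurableSet_singleton l)
  let f : E × κ → ℝ := A.indicator 1
  have hf : Measurable f := measurable_one.indicator hA
  let Y : Fin n → Ω → ℝ := fun i => f ∘ X i
  have hY : ∀ i, Measurable (Y i) := fun i => hf.comp (hX i)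
  have hbound : ∀ i ω, Y i ω ∈ Set.Icc (0 : ℝ) 1 := by
    intro i ω
    simp only [Y, f, Function.comp_apply, Set.indicator_apply]
    split_ifs <;> simp
  have hLp : ∀ i, MemLp (Y i) 2 P := fun i =>
    memLp_of_bounded (Filter.Eventually.of_forall (hbound i)) (hY i).aestronglyMeasurable 2
  have hmean : ∀ i, P[Y i] = w := by
    intro i
    have h1 : ∫ ω, Y i ω ∂P = ∫ u, f u ∂Q := by
      rw [← hQ i, integral_map (hX i).aemeasurable hf.aestronglyMeasurable]
      rfl
    rw [h1, integral_indicator_one hA, measureReal_def, hl, ENNReal.toReal_ofReal hw.le]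
  have hvar : ∀ i, Var[Y i; P] ≤ 1 / 4 := by
    intro i
    refine (variance_le_sq_of_bounded (Filter.Eventually.of_forall (hbound i))
      (hY i).aemeasurable).trans ?_
    norm_num
  have hindY : iIndepFun Y P := hind.comp (fun _ => f) fun _ => hf
  have hsum : Var[∑ i, Y i; P] ≤ n / 4 := by
    rw [IndepFun.variance_sum (fun i _ => hLp i) fun i _ j _ hij => hindY.indepFun hij]
    refine (Finset.sum_le_sum fun i _ => hvar i).trans ?_
    simp [div_eq_mul_inv]
  have hEsum : P[∑ i, Y i] = n * w := by
    simp only [Finset.sum_apply]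
    rw [integral_finsetSum _ fun i _ => (hLp i).integrable one_le_two]
    simp [hmean]
  have hnw : (0 : ℝ) < n * w / 2 := by positivity
  -- Chebyshev: a count below `n w / 2` deviates from its mean `n w` by at least `n w / 2`.
  have hcheb := meas_ge_le_variance_div_sq (memLp_finsetSum' Finset.univ fun i _ => hLp i) hnw
  rw [hEsum] at hcheb
  refine (measure_mono fun ω hω => ?_).trans (hcheb.trans (ENNReal.ofReal_le_ofReal ?_))
  · have hcount : (∑ i, Y i) ω = ((Finset.card {i | (X i ω).2 = l} : ℕ) : ℝ) := by
      simp [Y, f, A, Set.indicator_apply]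
    simp only [Set.mem_ofPred_eq] at hω ⊢
    rw [hcount, abs_sub_comm]
    refine le_trans ?_ (le_abs_self _)
    linarith
  · have hn' : (0 : ℝ) < n := by exact_mod_cast hn
    calc Var[∑ i, Y i; P] / (n * w / 2) ^ 2 ≤ (n / 4) / (n * w / 2) ^ 2 := by gcongr
      _ = 1 / (n * w ^ 2) := by field_simp; norm_num

variable {d L n b : ℕ}

theorem empiricalMean_apply (D : Fin n → Measure (EuclideanSpace ℝ (Fin d)))
    (A : Set (EuclideanSpace ℝ (Fin d))) :
    empiricalMean D A = (n : ℝ≥0∞)⁻¹ * ∑ i, D i A := by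
  simp [empiricalMean, Measure.finsetSum_apply]

theorem measurable_empiricalMean_apply {A : Set (EuclideanSpace ℝ (Fin d))}
    (hA : MeasurableSet A) :
    Measurable fun x : Fin n → Measure (EuclideanSpace ℝ (Fin d)) × Fin L =>
      empiricalMean (fun i => (x i).1) A := by
  simp_rw [empiricalMean_apply]
  refine Measurable.const_mul (Finset.measurable_sum _ fun i _ => ?_) _
  exact (Measure.measurable_coe hA).comp (measurable_fst.comp (measurable_pi_apply i))

/-- The probability that a normalized measure assigns to the codebooks without a point in a set of
mass at least `τ`. -/
theorem pi_normalized_avoid_le {α : Type*} [MeasurableSpace α] {m : Measure α} {τ K : ℝ≥0∞}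
    (hτ : τ ≠ 0) (hK : K ≠ ∞) {A : Set α} (hA : MeasurableSet A) (hm : m Set.univ ≤ K)
    (hmA : τ ≤ m A) :
    Measure.pi (fun _ : Fin b => (m Set.univ)⁻¹ • m) {c | ∀ j, c j ∉ A} ≤ (1 - τ / K) ^ b := by
  have hpos : m Set.univ ≠ 0 := by
    intro h
    have : m A ≤ 0 := h ▸ measure_mono (Set.subset_univ A)
    exact hτ (le_antisymm (hmA.trans this) zero_le)
  have hfin : m Set.univ ≠ ∞ := ne_top_of_le_ne_top hK hm
  have hprob : IsProbabilityMeasure ((m Set.univ)⁻¹ • m) :=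
    ⟨by simp [ENNReal.inv_mul_cancel hpos hfin]⟩
  have hset : {c : Fin b → α | ∀ j, c j ∉ A} = Set.univ.pi fun _ => Aᶜ := by
    ext c; simp [Set.mem_pi]
  rw [hset, Measure.pi_pi, Finset.prod_const, Finset.card_univ, Fintype.card_fin]
  gcongr
  -- After normalization `A` has probability at least `τ / K`, as the total mass is at most `K`.
  rw [prob_compl_eq_one_sub hA]
  gcongr
  rw [Measure.smul_apply, smul_eq_mul, ENNReal.div_eq_inv_mul]
  gcongr

/-- A set of mass at least `τ` is missed by all the initial codepoints with small probability. -/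
theorem IsSampledFromMean.measure_avoid_le {Ω : Type*} [MeasurableSpace Ω] {P : Measure Ω}
    [IsProbabilityMeasure P] {X : Fin n → Ω → Measure (EuclideanSpace ℝ (Fin d)) × Fin L}
    {c₀ : Ω → Codebook d b} (h : IsSampledFromMean P X c₀) {τ K : ℝ≥0∞}
    (hτ : τ ≠ 0) (hK : K ≠ ∞) {A : Set (EuclideanSpace ℝ (Fin d))} (hA : MeasurableSet A) :
    P {ω | empiricalMean (fun i => (X i ω).1) Set.univ ≤ K ∧
        τ ≤ empiricalMean (fun i => (X i ω).1) A ∧ ∀ j, c₀ ω j ∉ A} ≤ (1 - τ / K) ^ b := by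
  -- `T` constrains the data alone, and its lower bound on the mass excludes the zero mean measure,
  -- so the conditional law of `c₀` applies on it.
  let T : Set (Fin n → Measure (EuclideanSpace ℝ (Fin d)) × Fin L) :=
    {x | empiricalMean (fun i => (x i).1) Set.univ ≤ K ∧ τ ≤ empiricalMean (fun i => (x i).1) A}
  have hT : MeasurableSet T :=
    (measurableSet_le (measurable_empiricalMean_apply .univ) measurable_const).inter
      (measurableSet_le measurable_const (measurable_empiricalMean_apply hA))
  have hne : ∀ x ∈ T, empiricalMean (fun i => (x i).1) ≠ 0 := by
    intro x hx h0
    have := hx.2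
    rw [h0] at this
    exact hτ (le_antisymm this zero_le)
  have hS : MeasurableSet {c : Codebook d b | ∀ j, c j ∉ A} := by
    have : {c : Codebook d b | ∀ j, c j ∉ A} = ⋂ j, (fun c => c j) ⁻¹' Aᶜ := by
      ext c; simp
    rw [this]
    exact .iInter fun j => measurable_pi_apply j hA.compl
  have key := h T hT hne _ hS
  have hset : {ω | empiricalMean (fun i => (X i ω).1) Set.univ ≤ K ∧
        τ ≤ empiricalMean (fun i => (X i ω).1) A ∧ ∀ j, c₀ ω j ∉ A} =
      {ω | (fun i => X i ω) ∈ T ∧ c₀ ω ∈ {c : Codebook d b | ∀ j, c j ∉ A}} := by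
    ext ω; simp [T, and_assoc]
  rw [hset, key]
  calc _ ≤ ∫⁻ _ in {ω | (fun i => X i ω) ∈ T}, (1 - τ / K) ^ b ∂P :=
        setLIntegral_mono measurable_const fun ω hω =>
          pi_normalized_avoid_le hτ hK hA hω.1 hω.2
    _ = (1 - τ / K) ^ b * P {ω | (fun i => X i ω) ∈ T} := setLIntegral_const _ _
    _ ≤ (1 - τ / K) ^ b := mul_le_of_le_one_right zero_le prob_le_one

end Probability

/-! ### Quantization cost and position of the codepoints -/

section Covering

variable {d b : ℕ} {ι : Type*} [Fintype ι]

open Classical in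
/-- The quantization cost of a codebook with a point in each of the balls of a cover that contain
at least `T` points of the family. -/
theorem quantizationCost_le_of_hit {x : ι → EuclideanSpace ℝ (Fin d)} {R ε T : ℝ}
    (hT0 : 0 ≤ T) (hεR : ε ≤ R)
    (hx : ∀ k, x k ∈ Metric.closedBall 0 R) {t : Finset (EuclideanSpace ℝ (Fin d))}
    (ht : ∀ z ∈ t, z ∈ Metric.closedBall 0 R)
    (hcover : Metric.closedBall 0 R ⊆ ⋃ z ∈ t, Metric.ball z ε) (c : Codebook d b)
    (hhit : ∀ z ∈ t, T ≤ ((Finset.card {k | x k ∈ Metric.ball z ε} : ℕ) : ℝ) →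
      ∃ j, c j ∈ Metric.ball z ε)
    (hT : t.card * T < Fintype.card ι) :
    quantizationCost x c ≤ Fintype.card ι * (2 * ε) ^ 2 + t.card * T * (3 * R) ^ 2 := by
  -- Points sharing a ball of the cover with a codepoint. Any other point lies in a ball that misses
  -- the codebook, and such a ball has fewer than `T` points.
  let G : Finset ι := {k | ∃ z ∈ t, x k ∈ Metric.ball z ε ∧ ∃ j, c j ∈ Metric.ball z ε}
  have hlight : (Gᶜ.card : ℝ) ≤ t.card * T := by
    let t' : Finset (EuclideanSpace ℝ (Fin d)) := {z ∈ t | ¬ ∃ j, c j ∈ Metric.ball z ε}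
    have hsub : Gᶜ ⊆ t'.biUnion fun z => {k | x k ∈ Metric.ball z ε} := by
      intro k hk
      obtain ⟨z, hz, hkz⟩ := Set.mem_iUnion₂.1 (hcover (hx k))
      simp only [Finset.mem_biUnion]
      refine ⟨z, ?_, by simpa using hkz⟩
      refine Finset.mem_filter.2 ⟨hz, fun hj => ?_⟩
      exact Finset.mem_compl.1 hk
        (Finset.mem_filter.2 ⟨Finset.mem_univ k, z, hz, hkz, hj⟩)
    have hsmall : ∀ z ∈ t', ((Finset.card {k | x k ∈ Metric.ball z ε} : ℕ) : ℝ) ≤ T := by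
      intro z hz
      obtain ⟨hz, hj⟩ := Finset.mem_filter.1 hz
      exact (not_le.1 fun h => hj (hhit z hz h)).le
    have h1 : (Gᶜ.card : ℝ) ≤ ∑ z ∈ t', ((Finset.card {k | x k ∈ Metric.ball z ε} : ℕ) : ℝ) := by
      exact_mod_cast (Finset.card_le_card hsub).trans Finset.card_biUnion_le
    refine h1.trans ((Finset.sum_le_sum hsmall).trans ?_)
    rw [Finset.sum_const, nsmul_eq_mul]
    gcongr
    exact Finset.filter_subset _ _
  have hG : ∀ k ∈ G, Metric.infDist (x k) (Set.range c) ≤ 2 * ε := by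
    intro k hk
    obtain ⟨-, z, -, hkz, j, hj⟩ := Finset.mem_filter.1 hk
    refine (infDist_range_le c (x k) j).trans ?_
    rw [← dist_eq_norm]
    rw [Metric.mem_ball] at hkz hj
    linarith [dist_triangle_right (x k) (c j) z]
  -- By `hT` the points outside `G` cannot be the whole family, so some codepoint lies in a ball of
  -- the cover, hence within `R + ε ≤ 2 * R` of the origin.
  have hfar : ∀ k, Metric.infDist (x k) (Set.range c) ≤ 3 * R := by
    have hGne : G.Nonempty := by
      by_contra hne
      rw [Finset.not_nonempty_iff_eq_empty.1 hne, Finset.compl_empty, Finset.card_univ] at hlight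
      linarith
    obtain ⟨k₀, hk₀⟩ := hGne
    obtain ⟨-, z, hz, -, j, hj⟩ := Finset.mem_filter.1 hk₀
    intro k
    refine (infDist_range_le c (x k) j).trans ?_
    rw [← dist_eq_norm]
    have h1 := Metric.mem_closedBall.1 (hx k)
    have h2 := Metric.mem_closedBall'.1 (ht z hz)
    have h3 := Metric.mem_ball'.1 hj
    linarith [dist_triangle4 (x k) 0 z (c j)]
  rw [quantizationCost, ← Finset.sum_add_sum_compl G]
  refine add_le_add ?_ ?_
  · calc ∑ k ∈ G, Metric.infDist (x k) (Set.range c) ^ 2 ≤ ∑ _k ∈ G, (2 * ε) ^ 2 :=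
          Finset.sum_le_sum fun k hk => pow_le_pow_left₀ Metric.infDist_nonneg (hG k hk) 2
      _ = G.card * (2 * ε) ^ 2 := by rw [Finset.sum_const, nsmul_eq_mul]
      _ ≤ Fintype.card ι * (2 * ε) ^ 2 := by gcongr; exact Finset.card_le_univ G
  · calc ∑ k ∈ Gᶜ, Metric.infDist (x k) (Set.range c) ^ 2 ≤ ∑ _k ∈ Gᶜ, (3 * R) ^ 2 :=
          Finset.sum_le_sum fun k _ => pow_le_pow_left₀ Metric.infDist_nonneg (hfar k) 2
      _ = Gᶜ.card * (3 * R) ^ 2 := by rw [Finset.sum_const, nsmul_eq_mul]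
      _ ≤ t.card * T * (3 * R) ^ 2 := by gcongr

open Classical in
/-- A codebook of small quantization cost has a point near each point around which the family has
many points. -/
theorem exists_codepoint_near [NeZero b] {x : ι → EuclideanSpace ℝ (Fin d)}
    {p : EuclideanSpace ℝ (Fin d)} {η ρ : ℝ} (hηρ : η ≤ ρ) (c : Codebook d b)
    (hcost : quantizationCost x c <
      (Finset.card {k | dist (x k) p ≤ η} : ℕ) * (ρ - η) ^ 2) :
    ∃ j, dist p (c j) ≤ ρ := by
  by_contra! hfar
  refine absurd hcost (not_lt.2 ?_)
  rw [← nsmul_eq_mul, ← Finset.sum_const, quantizationCost]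
  refine (Finset.sum_le_sum fun k hk => ?_).trans (Finset.sum_le_sum_of_subset_of_nonneg
    (Finset.subset_univ _) fun k _ _ => sq_nonneg _)
  refine pow_le_pow_left₀ (sub_nonneg.2 hηρ) ?_ 2
  refine (Metric.le_infDist (Set.range_nonempty c)).2 ?_
  rintro _ ⟨j, rfl⟩
  have h1 : dist (x k) p ≤ η := by simpa using hk
  have h2 := hfar j
  linarith [dist_triangle_left p (c j) (x k)]

end Covering

/-! ### The deterministic separation statement -/

section Separation

variable {d b n L : ℕ}

theorem empiricalMean_sum_dirac {k : Fin n → ℕ}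
    (y : ∀ i, Fin (k i) → EuclideanSpace ℝ (Fin d)) :
    empiricalMean (fun i => ∑ j, Measure.dirac (y i j)) =
      (n : ℝ≥0∞)⁻¹ • ∑ s : Σ i, Fin (k i), Measure.dirac (y s.1 s.2) := by
  rw [empiricalMean, ← Fintype.sum_sigma']

open Classical in
/-- If every label that occurs is frequent and the initial codebook meets each heavy ball of a fine
cover, then Lloyd's algorithm returns a codebook whose vectorizations separate the labels. -/
theorem exists_lloydReturns_separates [NeZero b] {R η ρ σ₁ σ₂ Δ ε τ q : ℝ} {M : ℕ}
    {D₀ : Fin L → Measure (EuclideanSpace ℝ (Fin d))}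
    (hdistinct : ∀ l l', l ≠ l' → (D₀ l).support ≠ (D₀ l').support)
    (hΔ : ∀ l l', ∀ p ∈ (D₀ l).support, ∀ p' ∈ (D₀ l').support, p ≠ p' → Δ ≤ dist p p')
    (hη : 0 ≤ η) (hηρ : η ≤ ρ) (hσ₁ : 0 < σ₁)
    (hησ : M * (η / σ₁) ≤ 1 / 8) (hnear : ρ + η ≤ σ₁ / 4)
    (hfar : σ₂ * Real.log (4 * (M + 1)) ≤ Δ - ρ - η)
    (hεR : ε ≤ R) {t : Finset (EuclideanSpace ℝ (Fin d))}
    (ht : ∀ z ∈ t, z ∈ Metric.closedBall 0 R)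
    (hcover : Metric.closedBall 0 R ⊆ ⋃ z ∈ t, Metric.ball z ε)
    (hτ : 0 ≤ τ) (hτq : t.card * τ < q)
    (hcost : M * (2 * ε) ^ 2 + t.card * τ * (3 * R) ^ 2 < q * (ρ - η) ^ 2)
    (hn : 0 < n) {X : Fin n → Measure (EuclideanSpace ℝ (Fin d)) × Fin L}
    (hdiag : ∀ i, IsDiagram R M (X i).1) (hpert : ∀ i, IsPerturbation η (D₀ (X i).2) (X i).1)
    (hfreq : ∀ i, n * q ≤ (Finset.card {i' | (X i').2 = (X i).2} : ℕ)) (c₀ : Codebook d b)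
    (hhit : ∀ z ∈ t, ENNReal.ofReal τ ≤ empiricalMean (fun i => (X i).1) (Metric.ball z ε) →
      ∃ j, c₀ j ∈ Metric.ball z ε) :
    ∃ c : Codebook d b, LloydReturns (empiricalMean (fun i => (X i).1)) c₀ c ∧
      ∀ σ : Fin b → ℝ, (∀ i, σ i ∈ Set.Icc σ₁ σ₂) → Separates c σ X := by
  choose k hkM y hXy hy₁ hy₂ using fun i => (hpert i).exists_point (hdiag i)
  let x : (Σ i, Fin (k i)) → EuclideanSpace ℝ (Fin d) := fun s => y s.1 s.2
  have hn' : (0 : ℝ) < n := by exact_mod_cast hn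
  have hmean : empiricalMean (fun i => (X i).1) =
      (n : ℝ≥0∞)⁻¹ • ∑ s, Measure.dirac (x s) := by
    simp_rw [hXy]
    exact empiricalMean_sum_dirac y
  have hx : ∀ s, x s ∈ Metric.closedBall 0 R := by
    rintro ⟨i, j⟩
    obtain ⟨l, -, z, hz, hyz⟩ := hdiag i
    rw [hXy i] at hyz
    have hmem : y i j ∈ Set.range z := by
      rw [← support_sum_dirac, ← hyz, support_sum_dirac]
      exact Set.mem_range_self j
    obtain ⟨j', hj'⟩ := hmem
    have h := hz j'
    rwa [hj'] at h
  have hcard : (Fintype.card (Σ i, Fin (k i)) : ℝ) ≤ n * M := by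
    rw [Fintype.card_sigma]
    simp only [Fintype.card_fin]
    exact_mod_cast (Finset.sum_le_sum fun i _ => hkM i).trans (by simp)
  obtain ⟨c, hc, hcc₀⟩ := exists_lloydReturns (n : ℝ≥0∞)⁻¹ (by simp) (by simp [hn.ne']) x c₀
  refine ⟨c, hmean ▸ hc, fun σ hσ => ?_⟩
  have hcode : ∀ i, ∀ p ∈ (D₀ (X i).2).support, ∃ j, dist p (c j) ≤ ρ := by
    intro i p hp
    -- Each diagram with the label of `X i` has at least one point within `η` of `p`; projecting
    -- these points to their diagram index counts the diagrams.
    have hH : n * q ≤ (Finset.card {s | dist (x s) p ≤ η} : ℕ) := by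
      refine (hfreq i).trans (Nat.cast_le.2 ?_)
      refine le_trans (Finset.card_le_card fun i' hi' => ?_)
        (Finset.card_image_le (f := fun s : Σ i, Fin (k i) => s.1))
      have hi'' : (X i').2 = (X i).2 := by simpa using hi'
      obtain ⟨j, hj⟩ := hy₁ i' p (by rwa [hi''])
      exact Finset.mem_image.2 ⟨⟨i', j⟩, by simpa [x] using hj, rfl⟩
    refine exists_codepoint_near hηρ c (hcc₀.trans_lt ?_)
    have hHι : ((Finset.card {s | dist (x s) p ≤ η} : ℕ) : ℝ) ≤
        Fintype.card (Σ i, Fin (k i)) := by exact_mod_cast Finset.card_le_univ _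
    have hle := quantizationCost_le_of_hit (T := n * τ) (by positivity) hεR hx ht hcover c₀ ?_ ?_
    · calc _ ≤ _ := hle
        _ ≤ n * M * (2 * ε) ^ 2 + t.card * (n * τ) * (3 * R) ^ 2 := by gcongr
        _ = n * (M * (2 * ε) ^ 2 + t.card * τ * (3 * R) ^ 2) := by ring
        _ < n * (q * (ρ - η) ^ 2) := by gcongr
        _ = n * q * (ρ - η) ^ 2 := by ring
        _ ≤ _ := by gcongr
    · intro z hz hT
      refine hhit z hz ?_
      rw [hmean, smul_sum_dirac_apply _ _ Metric.isOpen_ball.measurableSet]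
      refine ENNReal.ofReal_le_of_le_toReal ?_
      rw [ENNReal.toReal_mul, ENNReal.toReal_inv, ENNReal.toReal_natCast, ENNReal.toReal_natCast,
        inv_mul_eq_div, le_div_iff₀ hn', mul_comm]
      exact hT
    · calc t.card * (n * τ) = n * (t.card * τ) := by ring
        _ < n * q := by gcongr
        _ ≤ _ := hH.trans hHι
  have hfar' : ∀ j, σ j * Real.log (4 * (M + 1)) ≤ Δ - ρ - η := fun j => by
    refine le_trans ?_ hfar
    refine mul_le_mul_of_nonneg_right (hσ j).2 (Real.log_nonneg ?_)
    linarith [(Nat.cast_nonneg M : (0 : ℝ) ≤ M)]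
  have hnear' : ∀ j, ρ + η ≤ σ j / 4 := fun j => by linarith [(hσ j).1]
  intro i i'
  refine ⟨fun hl => ?_, fun hl => ?_⟩
  · have h1 := norm_vAtol_sub_le (hdiag i) (hpert i) hη hσ₁ c fun j => (hσ j).1
    have h2 := norm_vAtol_sub_le (hdiag i') (hpert i') hη hσ₁ c fun j => (hσ j).1
    rw [hl, norm_sub_rev] at h1
    linarith [norm_sub_le_norm_sub_add_norm_sub (vAtol c σ (X i).1)
      (vAtol c σ (D₀ (X i').2)) (vAtol c σ (X i').1)]
  -- Two different supports are not included in each other both ways, and the norm is symmetric, so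
  -- one direction is enough.
  · have key : ∀ i i', ¬ (D₀ (X i).2).support ⊆ (D₀ (X i').2).support →
        1 / 2 ≤ ‖vAtol c σ (X i).1 - vAtol c σ (X i').1‖ := by
      intro i i' hnot
      obtain ⟨p, hp, hp'⟩ := Set.not_subset.1 hnot
      obtain ⟨j, hj⟩ := hcode i p hp
      exact le_norm_vAtol_sub (hdiag i) (hpert i) (hdiag i') (hpert i') hp
        (fun p' hpp' => hΔ _ _ p hp p' hpp' fun h => hp' (h ▸ hpp')) c hj
        (hσ₁.trans_le (hσ j).1) (hnear' j) (hfar' j)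
    by_cases hsub : (D₀ (X i).2).support ⊆ (D₀ (X i').2).support
    · rw [norm_sub_rev]
      exact key i' i fun h => hdistinct _ _ hl (hsub.antisymm h)
    · exact key i i' hsub

end Separation

/-! ### Choice of the constants and the final union bound -/

section Main

theorem Set.Finite.exists_pos_forall_le {s : Set ℝ} (hs : s.Finite) (hpos : ∀ x ∈ s, 0 < x) :
    ∃ ε > 0, ∀ x ∈ s, ε ≤ x := by
  rcases s.eq_empty_or_nonempty with rfl | hne
  · exact ⟨1, one_pos, by simp⟩
  · obtain ⟨a, ha, hmin⟩ := Set.exists_min_image s id hs hne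
    exact ⟨a, hpos a ha, hmin⟩

theorem exists_separation_of_supports {d L : ℕ} {R : ℝ} {M : ℕ}
    {D₀ : Fin L → Measure (EuclideanSpace ℝ (Fin d))} (hD₀ : ∀ l, IsDiagram R M (D₀ l)) :
    ∃ Δ > 0, ∀ l l', ∀ p ∈ (D₀ l).support, ∀ p' ∈ (D₀ l').support, p ≠ p' → Δ ≤ dist p p' := by
  let S : Set (EuclideanSpace ℝ (Fin d)) := ⋃ l, (D₀ l).support
  have hS : S.Finite := Set.finite_iUnion fun l => (hD₀ l).support_finite
  have hT : ((fun u : _ × _ => dist u.1 u.2) '' ((S ×ˢ S) \ Set.diagonal _)).Finite :=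
    ((hS.prod hS).subset Set.sdiff_subset).image _
  obtain ⟨Δ, hΔ, h⟩ := hT.exists_pos_forall_le (by
    rintro _ ⟨⟨p, p'⟩, ⟨-, hne⟩, rfl⟩
    exact dist_pos.2 hne)
  exact ⟨Δ, hΔ, fun l l' p hp p' hp' hne => h _ ⟨(p, p'),
    ⟨⟨Set.mem_iUnion.2 ⟨l, hp⟩, Set.mem_iUnion.2 ⟨l', hp'⟩⟩, hne⟩, rfl⟩⟩

theorem IsDiagram.measure_univ_le {d : ℕ} {R : ℝ} {M : ℕ}
    {μ : Measure (EuclideanSpace ℝ (Fin d))} (h : IsDiagram R M μ) : μ Set.univ ≤ M := by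
  obtain ⟨k, hk, x, -, rfl⟩ := h
  simpa [Measure.finsetSum_apply] using hk

theorem empiricalMean_univ_le {d n : ℕ} {R : ℝ} {M : ℕ}
    {D : Fin n → Measure (EuclideanSpace ℝ (Fin d))} (h : ∀ i, IsDiagram R M (D i)) :
    empiricalMean D Set.univ ≤ M := by
  rw [empiricalMean_apply]
  calc (n : ℝ≥0∞)⁻¹ * ∑ i, D i Set.univ ≤ (n : ℝ≥0∞)⁻¹ * ∑ _i : Fin n, (M : ℝ≥0∞) := by
        gcongr with i
        exact (h i).measure_univ_le
    _ = ((n : ℝ≥0∞)⁻¹ * n) * M := by simp [mul_assoc]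
    _ ≤ M := mul_le_of_le_one_left zero_le (ENNReal.inv_mul_le_one _)

/-- Labels of zero weight almost surely never occur, so the frequency bound only has to be uniform
over the positive weights. -/
theorem IsNoisyMixture.ae_weight_pos {d L : ℕ} {R : ℝ} {M : ℕ}
    {D₀ : Fin L → Measure (EuclideanSpace ℝ (Fin d))} {w : Fin L → ℝ} {η : ℝ}
    {Q : Measure (Measure (EuclideanSpace ℝ (Fin d)) × Fin L)}
    (h : IsNoisyMixture R M D₀ w η Q) : ∀ᵐ p ∂Q, 0 < w p.2 := by
  have hl : ∀ l, ∀ᵐ p ∂Q, p.2 = l → 0 < w l := by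
    intro l
    by_cases hw : 0 < w l
    · exact Filter.Eventually.of_forall fun _ _ => hw
    · have h0 : Q (Prod.snd ⁻¹' {l}) = 0 := by
        rw [h.weight l, ENNReal.ofReal_eq_zero]
        exact not_lt.1 hw
      filter_upwards [measure_eq_zero_iff_ae_notMem.1 h0] with p hp hpl
      exact absurd hpl hp
  filter_upwards [ae_all_iff.2 hl] with p hp using hp _ rfl

/-- Fine covers of a disc, together with a mass threshold for their balls. -/
theorem exists_cover_threshold {d : ℕ} {R q γ : ℝ} (hR : 0 < R) (hq : 0 < q) (hγ : 0 < γ)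
    (M : ℕ) : ∃ (ε τ : ℝ) (t : Finset (EuclideanSpace ℝ (Fin d))), ε ≤ R ∧ 0 < τ ∧
      (∀ z ∈ t, z ∈ Metric.closedBall (0 : EuclideanSpace ℝ (Fin d)) R) ∧
      Metric.closedBall 0 R ⊆ ⋃ z ∈ t, Metric.ball z ε ∧ t.card * τ < q ∧
      M * (2 * ε) ^ 2 + t.card * τ * (3 * R) ^ 2 < γ := by
  have hM : (0 : ℝ) < M + 1 := by positivity
  -- This radius makes the near term at most `γ / 2`. Below, `s` bounds the total mass of the light
  -- balls, which keeps the far term at most `γ / 4`.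
  let ε := min R (Real.sqrt (γ / (8 * (M + 1))))
  have hε : 0 < ε := lt_min hR (Real.sqrt_pos.2 (by positivity))
  have hε2 : ε ^ 2 ≤ γ / (8 * (M + 1)) := by
    rw [← Real.sq_sqrt (by positivity : 0 ≤ γ / (8 * ((M : ℝ) + 1)))]
    exact pow_le_pow_left₀ hε.le (min_le_right _ _) 2
  obtain ⟨t', ht', hfin, hcover⟩ :=
    (isCompact_closedBall (0 : EuclideanSpace ℝ (Fin d)) R).finite_cover_balls hε
  lift t' to Finset (EuclideanSpace ℝ (Fin d)) using hfin
  have hN : (0 : ℝ) < t'.card + 1 := by positivity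
  let s := min (q / 2) (γ / (36 * R ^ 2))
  have hs : 0 < s := lt_min (by positivity) (by positivity)
  have hNs : t'.card * (s / (t'.card + 1)) ≤ s := by
    rw [← mul_div_assoc, div_le_iff₀ hN]
    nlinarith
  refine ⟨ε, s / (t'.card + 1), t', min_le_left _ _, by positivity,
    fun z hz => ht' hz, hcover, ?_, ?_⟩
  · have : s ≤ q / 2 := min_le_left _ _
    linarith
  · have h1 : (M : ℝ) * (2 * ε) ^ 2 ≤ γ / 2 := by
      calc (M : ℝ) * (2 * ε) ^ 2 ≤ (M + 1) * (4 * ε ^ 2) := by nlinarith [sq_nonneg ε]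
        _ ≤ (M + 1) * (4 * (γ / (8 * (M + 1)))) := by gcongr
        _ = γ / 2 := by field_simp; norm_num
    have h2 : t'.card * (s / (t'.card + 1)) * (3 * R) ^ 2 ≤ γ / 4 := by
      calc t'.card * (s / (t'.card + 1)) * (3 * R) ^ 2
          ≤ γ / (36 * R ^ 2) * (3 * R) ^ 2 := by
            gcongr
            exact hNs.trans (min_le_right _ _)
        _ = γ / 4 := by field_simp; norm_num
    linarith

/-- The noise level and the range of bandwidths that suit the separation `Δ` of the supports. -/
theorem exists_bandwidths {Δ : ℝ} (hΔ : 0 < Δ) (M : ℕ) :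
    ∃ σ₁ σ₂ ρ η₀ : ℝ, 0 < σ₁ ∧ σ₁ < σ₂ ∧ 0 < η₀ ∧ η₀ < ρ ∧ M * (η₀ / σ₁) ≤ 1 / 8 ∧
      ρ + η₀ ≤ σ₁ / 4 ∧ σ₂ * Real.log (4 * (M + 1)) ≤ Δ - ρ - η₀ := by
  have hM : (0 : ℝ) ≤ M := Nat.cast_nonneg M
  have hlog : 1 ≤ Real.log (4 * (M + 1)) := by
    rw [Real.le_log_iff_exp_le (by positivity)]
    linarith [Real.exp_one_lt_d9]
  set ℓ := Real.log (4 * (M + 1))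
  have hσ : 0 < Δ / (4 * ℓ) := by positivity
  have hσΔ : Δ / (4 * ℓ) ≤ Δ / 4 := by gcongr; linarith
  have hη : Δ / (4 * ℓ) / (16 * (M + 1)) ≤ Δ / (4 * ℓ) / 16 := by gcongr; linarith
  -- The choice `σ₂ = 2 * σ₁` gives `σ₂ * ℓ = Δ / 2`. Since `ρ + η₀ ≤ 3 * σ₁ / 16` and `σ₁ ≤ Δ / 4`,
  -- the other half of `Δ` covers `ρ + η₀`.
  refine ⟨Δ / (4 * ℓ), 2 * (Δ / (4 * ℓ)), Δ / (4 * ℓ) / 8, Δ / (4 * ℓ) / (16 * (M + 1)), hσ,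
    by linarith, by positivity, by linarith, ?_, by linarith, ?_⟩
  · rw [div_right_comm, div_self hσ.ne', mul_one_div, div_le_div_iff₀ (by positivity) (by norm_num)]
    linarith
  · have : 2 * (Δ / (4 * ℓ)) * ℓ = Δ / 2 := by field_simp; norm_num
    linarith

theorem exists_nat_forall_mul_pow_le {r N e : ℝ≥0∞} (hr : r < 1) (hN : N ≠ ∞) (he : e ≠ 0) :
    ∃ b₀ : ℕ, ∀ b ≥ b₀, N * r ^ b ≤ e := by
  have h := ENNReal.Tendsto.const_mul (ENNReal.tendsto_pow_atTop_nhds_zero_of_lt_one hr)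
    (Or.inr hN)
  rw [mul_zero] at h
  obtain ⟨b₀, hb₀⟩ := Filter.eventually_atTop.1 (h.eventually_lt_const (pos_iff_ne_zero.2 he))
  exact ⟨b₀, fun b hb => (hb₀ b hb).le⟩

theorem exists_nat_forall_mul_ofReal_inv_le {r : ℝ} {N e : ℝ≥0∞} (hN : N ≠ ∞)
    (he : e ≠ 0) :
    ∃ n₀ : ℕ, ∀ n ≥ n₀, N * ENNReal.ofReal (1 / (n * r)) ≤ e := by
  have h0 : Filter.Tendsto (fun n : ℕ => 1 / (n * r)) Filter.atTop (nhds 0) := by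
    have := (tendsto_one_div_atTop_nhds_zero_nat (𝕜 := ℝ)).mul_const (1 / r)
    rw [zero_mul] at this
    refine this.congr fun n => ?_
    rw [one_div_mul_one_div]
  have h := ENNReal.Tendsto.const_mul (ENNReal.tendsto_ofReal h0) (Or.inr hN)
  rw [ENNReal.ofReal_zero, mul_zero] at h
  obtain ⟨n₀, hn₀⟩ := Filter.eventually_atTop.1 (h.eventually_lt_const (pos_iff_ne_zero.2 he))
  exact ⟨n₀, fun n hn => (hn₀ n hn).le⟩

end Main

theorem theorem1 (R : ℝ) (hR : 0 < R) (M L : ℕ)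
    (D₀ : Fin L → Measure (EuclideanSpace ℝ (Fin 2)))
    (hD₀ : ∀ l, IsDiagram R M (D₀ l))
    (hdistinct : ∀ l l', l ≠ l' → (D₀ l).support ≠ (D₀ l').support) :
    ∃ η₀ : ℝ, 0 < η₀ ∧ ∀ η : ℝ, 0 ≤ η → η ≤ η₀ →
      ∃ σ₁ σ₂ : ℝ, 0 < σ₁ ∧ σ₁ < σ₂ ∧
        ∀ w : Fin L → ℝ, (∀ l, 0 ≤ w l) → ∑ l, w l = 1 →
        ∀ δ : ℝ, 0 < δ → ∃ b₀ n₀ : ℕ, ∀ b ≥ b₀, ∀ n ≥ n₀,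
          ∀ Q : Measure (Measure (EuclideanSpace ℝ (Fin 2)) × Fin L),
            IsNoisyMixture R M D₀ w η Q →
            (∃ r₀ : ℝ, 0 < r₀ ∧ MarginCondition R b (meanMeasure Q) r₀) →
            ∀ (Ω : Type*) [MeasurableSpace Ω] (P : Measure Ω) [IsProbabilityMeasure P]
              (X : Fin n → Ω → Measure (EuclideanSpace ℝ (Fin 2)) × Fin L)
              (c₀ : Ω → Codebook 2 b),
              (∀ i, Measurable (X i)) → (∀ i, P.map (X i) = Q) → iIndepFun X P →
              Measurable c₀ → IsSampledFromMean P X c₀ →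
              P {ω | ¬ ∃ c : Codebook 2 b,
                  LloydReturns (empiricalMean (fun i => (X i ω).1)) (c₀ ω) c ∧
                  ∀ σ : Fin b → ℝ, (∀ i, σ i ∈ Set.Icc σ₁ σ₂) →
                    Separates c σ (fun i => X i ω)} ≤ ENNReal.ofReal δ := by
  classical
  obtain ⟨Δ, hΔ0, hΔ⟩ := exists_separation_of_supports hD₀
  obtain ⟨σ₁, σ₂, ρ, η₀, hσ₁, hσ₁₂, hη₀, hη₀ρ, hησ, hnear, hfar⟩ := exists_bandwidths hΔ0 M
  refine ⟨η₀, hη₀, fun η hη0 hηη₀ => ⟨σ₁, σ₂, hσ₁, hσ₁₂, fun w hw hw1 δ hδ => ?_⟩⟩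
  -- Here `π` is a lower bound for the positive weights. It depends on `w` only, so `b₀` and `n₀`
  -- can be fixed before `Q`.
  obtain ⟨π, hπ0, hπ⟩ := ((Set.finite_range w).subset
    (Set.inter_subset_left (t := Set.Ioi 0))).exists_pos_forall_le fun x hx => hx.2
  have hηρ : η < ρ := hηη₀.trans_lt hη₀ρ
  -- The frequency `π / 2` is what Chebyshev guarantees, and `γ` is the cost per diagram that a
  -- support point without a nearby codepoint would force.
  obtain ⟨ε, τ, t, hεR, hτ, ht, hcover, hτq, hcost⟩ :=
    exists_cover_threshold (d := 2) (q := π / 2) (γ := π / 2 * (ρ - η) ^ 2) hR (by positivity)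
      (mul_pos (by positivity) (pow_pos (sub_pos.2 hηρ) 2)) M
  have hτ' : ENNReal.ofReal τ ≠ 0 := (ENNReal.ofReal_pos.2 hτ).ne'
  have hK : ((M : ℝ≥0∞) + 1) ≠ ∞ := by finiteness
  have hδ' : ENNReal.ofReal (δ / 2) ≠ 0 := (ENNReal.ofReal_pos.2 (by positivity)).ne'
  obtain ⟨b₀, hb₀⟩ := exists_nat_forall_mul_pow_le (r := 1 - ENNReal.ofReal τ / (M + 1))
    (N := t.card) (e := ENNReal.ofReal (δ / 2))
    (ENNReal.sub_lt_self ENNReal.one_ne_top one_ne_zero (ENNReal.div_ne_zero.2 ⟨hτ', hK⟩))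
    (ENNReal.natCast_ne_top _) hδ'
  obtain ⟨n₀, hn₀⟩ := exists_nat_forall_mul_ofReal_inv_le (r := π ^ 2) (N := L)
    (ENNReal.natCast_ne_top _) hδ'
  refine ⟨max b₀ 1, max n₀ 1, fun b hb n hn Q hQ _ Ω _ P _ X c₀ hX hXQ hind _ hc₀ => ?_⟩
  have hn1 : 0 < n := (le_max_right _ _).trans hn
  have hn1' : (0 : ℝ) < n := by exact_mod_cast hn1
  have : NeZero b := ⟨Nat.pos_iff_ne_zero.1 ((le_max_right _ _).trans hb)⟩
  -- Three kinds of exceptional events: `bad` is null, while the `rare` and the `avoid` events cost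
  -- at most `δ / 2` in total each.
  let bad : Set Ω := {ω | ¬ ∀ i, (IsDiagram R M (X i ω).1 ∧
    IsPerturbation η (D₀ (X i ω).2) (X i ω).1) ∧ 0 < w (X i ω).2}
  let rare : Fin L → Set Ω := fun l => {ω | 0 < w l ∧
    ((Finset.card {i | (X i ω).2 = l} : ℕ) : ℝ) < n * w l / 2}
  let avoid : EuclideanSpace ℝ (Fin 2) → Set Ω := fun z =>
    {ω | empiricalMean (fun i => (X i ω).1) Set.univ ≤ M + 1 ∧
      ENNReal.ofReal τ ≤ empiricalMean (fun i => (X i ω).1) (Metric.ball z ε) ∧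
      ∀ j, c₀ ω j ∉ Metric.ball z ε}
  have hbad : P bad = 0 := by
    refine ae_iff.1 (ae_all_iff.2 fun i => ?_)
    refine ae_of_ae_map (hX i).aemeasurable (p := fun u => (IsDiagram R M u.1 ∧
      IsPerturbation η (D₀ u.2) u.1) ∧ 0 < w u.2) ?_
    rw [hXQ i]
    exact hQ.noise.and hQ.ae_weight_pos
  have hrare : ∀ l, P (rare l) ≤ ENNReal.ofReal (1 / (n * π ^ 2)) := by
    intro l
    by_cases hl : 0 < w l
    · refine (measure_mono fun ω hω => hω.2).trans
        ((measure_label_count_lt_le hn1 P X hX hind hXQ hl (hQ.weight l)).trans ?_)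
      have hπl : π ≤ w l := hπ _ ⟨⟨l, rfl⟩, hl⟩
      gcongr
    · have : rare l = ∅ := by
        ext ω
        simp [rare, hl]
      simp [this]
  have havoid : ∀ z, P (avoid z) ≤ (1 - ENNReal.ofReal τ / (M + 1)) ^ b := fun z =>
    hc₀.measure_avoid_le hτ' hK Metric.isOpen_ball.measurableSet
  have hsub : {ω | ¬ ∃ c : Codebook 2 b,
      LloydReturns (empiricalMean (fun i => (X i ω).1)) (c₀ ω) c ∧
      ∀ σ : Fin b → ℝ, (∀ i, σ i ∈ Set.Icc σ₁ σ₂) → Separates c σ (fun i => X i ω)} ⊆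
      bad ∪ ((⋃ l ∈ (Finset.univ : Finset (Fin L)), rare l) ∪ ⋃ z ∈ t, avoid z) := by
    intro ω hω
    by_contra hgood
    simp only [Set.mem_union, Set.mem_iUnion, not_or, not_exists] at hgood
    obtain ⟨h1, h2, h3⟩ := hgood
    replace h1 := not_not.1 h1
    refine hω (exists_lloydReturns_separates (q := π / 2) hdistinct hΔ hη0 hηρ.le hσ₁ ?_
      (by linarith) (by linarith) hεR ht hcover hτ.le hτq hcost hn1 (fun i => (h1 i).1.1)
      (fun i => (h1 i).1.2) (fun i => ?_) (c₀ ω) fun z hz hmass => ?_)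
    · refine le_trans ?_ hησ
      gcongr
    · have hr := h2 (X i ω).2 (Finset.mem_univ _)
      have hle := not_lt.1 fun h => hr ⟨(h1 i).2, h⟩
      refine le_trans ?_ hle
      have hπl : π ≤ w (X i ω).2 := hπ _ ⟨⟨_, rfl⟩, (h1 i).2⟩
      rw [mul_div_assoc]
      gcongr
    · by_contra! hmiss
      exact h3 z hz ⟨(empiricalMean_univ_le fun i => (h1 i).1.1).trans le_self_add, hmass, hmiss⟩
  calc P _ ≤ P bad + (P (⋃ l ∈ (Finset.univ : Finset (Fin L)), rare l) + P (⋃ z ∈ t, avoid z)) :=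
        (measure_mono hsub).trans ((measure_union_le _ _).trans
          (add_le_add_right (measure_union_le _ _) _))
    _ ≤ 0 + (∑ _l : Fin L, ENNReal.ofReal (1 / (n * π ^ 2)) +
          ∑ _z ∈ t, (1 - ENNReal.ofReal τ / (M + 1)) ^ b) :=
        add_le_add hbad.le (add_le_add
          ((measure_biUnion_finset_le _ _).trans (Finset.sum_le_sum fun l _ => hrare l))
          ((measure_biUnion_finset_le _ _).trans (Finset.sum_le_sum fun z _ => havoid z)))
    _ ≤ ENNReal.ofReal (δ / 2) + ENNReal.ofReal (δ / 2) := by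
        rw [zero_add]
        simp only [Finset.sum_const, Finset.card_univ, Fintype.card_fin, nsmul_eq_mul]
        exact add_le_add (hn₀ n ((le_max_left _ _).trans hn)) (hb₀ b ((le_max_left _ _).trans hb))
    _ = ENNReal.ofReal δ := by
        rw [← ENNReal.ofReal_add (by positivity) (by positivity), add_halves]
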